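/- Let $a,b,\delta,l_0\in\mathbb{C}$ with $a,b\neq 0$, and put $p=a^2$, $q=b^2$. For a function $g$ of $(n,m)\in\mathbb{Z}^2$ write $\tilde g(n,m)=g(n+1,m)$, $\hat g(n,m)=g(n,m+1)$, $\hat{\tilde g}(n,m)=g(n+1,m+1)$. For $n,m\in\mathbb{Z}$ and integers $l\ge 0$ let $$\psi(n,m,l)=\tfrac12(1+s)^{l+l_0}(1+as)^n(1+bs)^m-\tfrac12(1-s)^{l+l_0}(1-as)^n(1-bs)^m$$ (principal powers, $s$ near $0$), and $\alpha_j(n,m,l)=\frac{1}{(2j+1)!}\,\partial_s^{2j+1}\psi(n,m,l)\big|_{s=0}$ for $j\ge 0$. For $N\ge 0$ let $f_N(n,m)=\det\big(\alpha_i(n,m,l)\big)_{0\le i,l\le N-1}$ (so $f_0=1$), and for $N\ge 1$ let $f_{-N}=(-1)^{\lfloor N/2\rfloor}f_{N-1}$. For every $N\in\mathbb{Z}$ put $$U_{N+2}=\frac{f_{N+1}^2-\delta^2 f_{N-1}^2}{f_N^2},\qquad u_{N+2}=\frac{f_{N+2}+\delta^2 f_{N-2}}{f_N}$$ at the lattice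 points where $f_N\neq 0$. Then for every $N\in\mathbb{Z}$ the following hold. 1. $U_{N+2}$ and $u_{N+2}$ are rational functions of $(n,m)$: each is a quotient of two complex polynomials in $n,m$ whose denominator is not the zero polynomial and vanishes at exactly those lattice points where $f_N$ does. 2. $U=U_{N+2}$ satisfies H3*($\delta$), $$\left[p(U\tilde U-\hat U\hat{\tilde U})-q(U\hat U-\tilde U\hat{\tilde U})\right]^2+4pq(\tilde U-\hat U)\left[\delta^2(p-q)(U-\hat{\tilde U})-U\hat{\tilde U}(\tilde U-\hat U)\right]=0,$$ and hence also its standard form $$(P-Q)\left[P(U\hat U-\tilde U\hat{\tilde U})^2-Q(U\tilde U-\hat U\hat{\tilde U})^2\right]+(U-\hat{\tilde U})(\tilde U-\hat U)\left[(U-\hat{\tilde U})(\tilde U-\hat U)PQ-4\delta^2(P-Q)\right]=0$$ with $P=1/p$, $Q=1/q$, on every elementary square at whose four vertices $f_N\ne 0$. 3. On the same squares $u=u_{N+2}$ satisfies Q1($\delta$), $$p(u-\hat u)(\tilde u-\hat{\tilde u})-q(u-\tilde u)(\hat u-\hat{\tilde u})+\delta^2pq(p-q)=0.$$ 4. $u=u_{N+2}$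 and $U=U_{N+2}$ are related by the Bäcklund transformation $$(\tilde u-u)^2-\delta^2p^2=p\,U\tilde U,\qquad (\hat u-u)^2-\delta^2q^2=q\,U\hat U,$$ each equation on every lattice edge at whose two end points $f_N\ne 0$. -/

import Mathlib

noncomputable section

namespace LatticeH3

/-- The quad equation Q1(δ) with lattice parameters `p`, `q`, for a function `u` of `(n, m)`, on the
elementary square with lower left corner `(n, m)`. -/
def Q1At (δ p q : ℂ) (u : ℤ → ℤ → ℂ) (n m : ℤ) : Prop :=
  p * (u n m - u n (m + 1)) * (u (n + 1) m - u (n + 1) (m + 1))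
    - q * (u n m - u (n + 1) m) * (u n (m + 1) - u (n + 1) (m + 1))
    + δ ^ 2 * p * q * (p - q) = 0

/-- The multi-quadratic quad equation H3*(δ; p, q) in its standard form. -/
def H3StarAt (δ p q : ℂ) (U : ℤ → ℤ → ℂ) (n m : ℤ) : Prop :=
  (p - q) * (p * (U n m * U n (m + 1) - U (n + 1) m * U (n + 1) (m + 1)) ^ 2
      - q * (U n m * U (n + 1) m - U n (m + 1) * U (n + 1) (m + 1)) ^ 2)
    + (U n m - U (n + 1) (m + 1)) * (U (n + 1) m - U n (m + 1))
      * ((U n m - U (n + 1) (m + 1)) * (U (n + 1) m - U n (m + 1)) * p * q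
          - 4 * δ ^ 2 * (p - q)) = 0

/-- H3*(δ) in the form in which it arises as the equation for `U` from the Bäcklund transformation
of Q1(δ; p, q). -/
def H3StarFormAt (δ p q : ℂ) (U : ℤ → ℤ → ℂ) (n m : ℤ) : Prop :=
  (p * (U n m * U (n + 1) m - U n (m + 1) * U (n + 1) (m + 1))
      - q * (U n m * U n (m + 1) - U (n + 1) m * U (n + 1) (m + 1))) ^ 2
    + 4 * p * q * (U (n + 1) m - U n (m + 1))
      * (δ ^ 2 * (p - q) * (U n m - U (n + 1) (m + 1))
          - U n m * U (n + 1) (m + 1) * (U (n + 1) m - U n (m + 1))) = 0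

/-- First half of the Bäcklund transformation, on the edge from `(n, m)` to `(n + 1, m)`. -/
def BTHorizontalAt (δ p : ℂ) (u U : ℤ → ℤ → ℂ) (n m : ℤ) : Prop :=
  (u (n + 1) m - u n m) ^ 2 - δ ^ 2 * p ^ 2 = p * U n m * U (n + 1) m

/-- Second half of the Bäcklund transformation, on the edge from `(n, m)` to `(n, m + 1)`. -/
def BTVerticalAt (δ q : ℂ) (u U : ℤ → ℤ → ℂ) (n m : ℤ) : Prop :=
  (u n (m + 1) - u n m) ^ 2 - δ ^ 2 * q ^ 2 = q * U n m * U n (m + 1)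

/-- The generating function `ψ = ψ⁺ + ψ⁻`, with
`ψ^± = ± (1/2) (1 ± s)^(l + l₀) (1 ± a s)^n (1 ± b s)^m`. -/
def psi (a b l₀ : ℂ) (n m : ℤ) (l : ℕ) (s : ℂ) : ℂ :=
  (1 / 2) * (1 + s) ^ ((l : ℂ) + l₀) * (1 + a * s) ^ n * (1 + b * s) ^ m
    + -(1 / 2) * (1 - s) ^ ((l : ℂ) + l₀) * (1 - a * s) ^ n * (1 - b * s) ^ m

/-- The `j`-th entry `∂_s^(2j+1) ψ |_{s = 0} / (2j+1)!` of the Casoratian vector. -/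
def alpha (a b l₀ : ℂ) (n m : ℤ) (l j : ℕ) : ℂ :=
  1 / ((2 * j + 1).factorial : ℂ) * iteratedDeriv (2 * j + 1) (psi a b l₀ n m l) 0

/-- The `N`-th order Casoratian `|α(n,m,0), α(n,m,1), …, α(n,m,N-1)|`; it equals `1` for `N = 0`. -/
def casoratian (a b l₀ : ℂ) (N : ℕ) (n m : ℤ) : ℂ :=
  (Matrix.of fun i l : Fin N => alpha a b l₀ n m (l : ℕ) (i : ℕ)).det

/-- The Casoratian for all integer orders: `f_{-K} = (-1)^⌊K/2⌋ f_{K-1}` for `K ≥ 1`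
(in the second case the order is `-(k + 1)`, so `K = k + 1`). -/
def f (a b l₀ : ℂ) : ℤ → ℤ → ℤ → ℂ
  | Int.ofNat N, n, m => casoratian a b l₀ N n m
  | Int.negSucc k, n, m => (-1) ^ ((k + 1) / 2) * casoratian a b l₀ k n m

/-- `u_{N+2} = (f_{N+2} + δ² f_{N-2}) / f_N`. -/
def uSol (a b δ l₀ : ℂ) (N n m : ℤ) : ℂ :=
  (f a b l₀ (N + 2) n m + δ ^ 2 * f a b l₀ (N - 2) n m) / f a b l₀ N n m

/-- `U_{N+2} = (f_{N+1}² - δ² f_{N-1}²) / f_N²`. -/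
def USol (a b δ l₀ : ℂ) (N n m : ℤ) : ℂ :=
  (f a b l₀ (N + 1) n m ^ 2 - δ ^ 2 * f a b l₀ (N - 1) n m ^ 2) / f a b l₀ N n m ^ 2

/-- `g` is a rational function `P / Q` of `(n, m)`, with `Q` a nonzero polynomial, where `D n m` holds
at exactly those lattice points at which the denominator `Q` does not vanish. -/
def IsRationalFunctionOn (D : ℤ → ℤ → Prop) (g : ℤ → ℤ → ℂ) : Prop :=
  ∃ P Q : MvPolynomial (Fin 2) ℂ, Q ≠ 0 ∧ ∀ n m : ℤ,
    (D n m ↔ MvPolynomial.eval ![(n : ℂ), (m : ℂ)] Q ≠ 0) ∧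
    (D n m → g n m =
      MvPolynomial.eval ![(n : ℂ), (m : ℂ)] P / MvPolynomial.eval ![(n : ℂ), (m : ℂ)] Q)

end LatticeH3

end

noncomputable section

namespace LatticeH3

/-! Let E be the Taylor series at 0 of (1+s)^l₀ (1+as)^n (1+bs)^m. The entries of the Casoratian are
the odd coefficients of (1+s)^l E, and a unitriangular column change replaces (1+s)^l by s^l, so f_N
is a determinant `tau E N` of coefficients of E. A step in n or m multiplies E by 1+as or 1+bs.

The one hard fact is the bilinear edge relation between three consecutive tau functions
(`tau_bilinear_of_ne_zero`). Its proof imitates orthogonal polynomials: monic polynomials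
annihilated by the first few odd-coefficient functionals carry ratios of consecutive tau functions
as constant terms and as values of the next functional. This needs nonzero tau functions; since they
are polynomial in (n,m), nonvanishing somewhere is enough, and the edge relation itself propagates
that (`exists_tau_ne_zero`).

For a ≠ b, induction on the order gives the relations on squares (`squarePair_tau`,
`squareTriple_tau`), and a reversal symmetry carries all of them to negative orders. The Bäcklund
transformation, Q1 and H3* then become algebraic identities in x = f_{N+1} and y = f_{N-1} (divided
by f_N for H3*). For a = b the two lattice directions coincide, and Q1 and H3* are trivial. -/

/-- The function `(n, m) ↦ F n m` is given by a polynomial in `(n, m)`. -/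
def IsPoly (F : ℤ → ℤ → ℂ) : Prop :=
  ∃ P : MvPolynomial (Fin 2) ℂ, ∀ n m : ℤ, F n m = MvPolynomial.eval ![(n : ℂ), (m : ℂ)] P

/-! ### Polynomial functions on the lattice form an integral domain. -/

namespace IsPoly

theorem const (c : ℂ) : IsPoly fun _ _ => c := ⟨MvPolynomial.C c, by simp⟩

theorem add {F G : ℤ → ℤ → ℂ} (hF : IsPoly F) (hG : IsPoly G) :
    IsPoly fun n m => F n m + G n m := by
  obtain ⟨P, hP⟩ := hF
  obtain ⟨Q, hQ⟩ := hG
  exact ⟨P + Q, by simp [hP, hQ]⟩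

theorem mul {F G : ℤ → ℤ → ℂ} (hF : IsPoly F) (hG : IsPoly G) :
    IsPoly fun n m => F n m * G n m := by
  obtain ⟨P, hP⟩ := hF
  obtain ⟨Q, hQ⟩ := hG
  exact ⟨P * Q, by simp [hP, hQ]⟩

theorem sub {F G : ℤ → ℤ → ℂ} (hF : IsPoly F) (hG : IsPoly G) :
    IsPoly fun n m => F n m - G n m := by
  obtain ⟨P, hP⟩ := hF
  obtain ⟨Q, hQ⟩ := hG
  exact ⟨P - Q, by simp [hP, hQ]⟩

theorem sum {ι : Type*} (s : Finset ι) {F : ι → ℤ → ℤ → ℂ} (hF : ∀ i, IsPoly (F i)) :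
    IsPoly fun n m => ∑ i ∈ s, F i n m := by
  choose P hP using hF
  exact ⟨∑ i ∈ s, P i, by simp [hP]⟩

theorem prod {ι : Type*} (s : Finset ι) {F : ι → ℤ → ℤ → ℂ} (hF : ∀ i, IsPoly (F i)) :
    IsPoly fun n m => ∏ i ∈ s, F i n m := by
  choose P hP using hF
  exact ⟨∏ i ∈ s, P i, by simp [hP]⟩

theorem det {ι : Type*} [Fintype ι] [DecidableEq ι] {M : ι → ι → ℤ → ℤ → ℂ}
    (hM : ∀ i j, IsPoly (M i j)) :
    IsPoly fun n m => (Matrix.of fun i j => M i j n m).det := by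
  simp only [Matrix.det_apply', Matrix.of_apply]
  exact sum _ fun σ => (const _).mul (prod _ fun i => hM _ _)

theorem shift {F : ℤ → ℤ → ℂ} (hF : IsPoly F) (k l : ℤ) :
    IsPoly fun n m => F (n + k) (m + l) := by
  obtain ⟨P, hP⟩ := hF
  refine ⟨MvPolynomial.aeval ![MvPolynomial.X 0 + MvPolynomial.C (k : ℂ),
    MvPolynomial.X 1 + MvPolynomial.C (l : ℂ)] P, fun n m => ?_⟩
  simp only []
  rw [hP, ← MvPolynomial.bind₁, MvPolynomial.eval, MvPolynomial.eval,
    MvPolynomial.eval₂Hom_bind₁]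
  congr 2
  funext i
  fin_cases i <;> simp

theorem fst (p : Polynomial ℂ) : IsPoly fun n _ => p.eval (n : ℂ) :=
  ⟨Polynomial.aeval (MvPolynomial.X 0) p, fun n m => by
    simp [Polynomial.aeval_def, Polynomial.hom_eval₂, -Polynomial.eval₂_algebraMap_X]⟩

theorem snd (p : Polynomial ℂ) : IsPoly fun _ m => p.eval (m : ℂ) :=
  ⟨Polynomial.aeval (MvPolynomial.X 1) p, fun n m => by
    simp [Polynomial.aeval_def, Polynomial.hom_eval₂, -Polynomial.eval₂_algebraMap_X]⟩

theorem eq_zero_of_eval {P : MvPolynomial (Fin 2) ℂ}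
    (h : ∀ n m : ℤ, MvPolynomial.eval ![(n : ℂ), (m : ℂ)] P = 0) : P = 0 := by
  refine MvPolynomial.funext_set (fun _ => Set.range ((↑) : ℤ → ℂ))
    (fun _ => Set.infinite_range_of_injective Int.cast_injective) fun x hx => ?_
  obtain ⟨n, hn⟩ := hx 0 trivial
  obtain ⟨m, hm⟩ := hx 1 trivial
  have : x = ![(n : ℂ), (m : ℂ)] := by
    funext i
    fin_cases i <;> simp [hn, hm]
  simp [this, h]

/-- Polynomial functions on the lattice have no zero divisors. -/
theorem cancel {F G : ℤ → ℤ → ℂ} (hF : IsPoly F) (hG : IsPoly G) (h0 : ∃ n m, F n m ≠ 0)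
    (h : ∀ n m, F n m ≠ 0 → G n m = 0) (n m : ℤ) : G n m = 0 := by
  obtain ⟨P, hP⟩ := hF
  obtain ⟨Q, hQ⟩ := hG
  have hPQ : P * Q = 0 := eq_zero_of_eval fun n m => by
    rw [map_mul, ← hP, ← hQ]
    by_cases h1 : F n m = 0
    · rw [h1, zero_mul]
    · rw [h n m h1, mul_zero]
  rcases mul_eq_zero.1 hPQ with h1 | h1
  · obtain ⟨n, m, h2⟩ := h0
    exact absurd (by simp [hP, h1]) h2
  · simp [hQ, h1]

theorem mul_ne_zero {F G : ℤ → ℤ → ℂ} (hF : IsPoly F) (hG : IsPoly G) (hF0 : ∃ n m, F n m ≠ 0)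
    (hG0 : ∃ n m, G n m ≠ 0) : ∃ n m, F n m * G n m ≠ 0 := by
  by_contra! h
  obtain ⟨n, m, h1⟩ := hG0
  exact h1 (cancel hF hG hF0 (fun n m h2 => (mul_eq_zero.1 (h n m)).resolve_left h2) n m)

end IsPoly

/-! ### Taylor series of the generating function. -/

/-- The Taylor series at `0` of a complex function. -/
def taylor (g : ℂ → ℂ) : PowerSeries ℂ :=
  PowerSeries.mk fun k => iteratedDeriv k g 0 / (k.factorial : ℂ)

theorem taylor_mul {g h : ℂ → ℂ} (hg : AnalyticAt ℂ g 0) (hh : AnalyticAt ℂ h 0) :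
    taylor (fun s => g s * h s) = taylor g * taylor h := by
  ext k
  rw [PowerSeries.coeff_mul, Finset.Nat.sum_antidiagonal_eq_sum_range_succ_mk]
  simp only [taylor, PowerSeries.coeff_mk]
  rw [iteratedDeriv_fun_mul hg.contDiffAt hh.contDiffAt, Finset.sum_div]
  refine Finset.sum_congr rfl fun i hi => ?_
  have hik : i ≤ k := Nat.lt_succ_iff.1 (Finset.mem_range.1 hi)
  rw [Nat.cast_choose ℂ hik]
  have h1 := Nat.factorial_ne_zero k
  have h2 := Nat.factorial_ne_zero i
  have h3 := Nat.factorial_ne_zero (k - i)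
  field_simp

theorem taylor_congr {g h : ℂ → ℂ} (hgh : g =ᶠ[nhds 0] h) : taylor g = taylor h := by
  ext k
  simp only [taylor, PowerSeries.coeff_mk, hgh.iteratedDeriv_eq k]

theorem taylor_linear (c : ℂ) :
    taylor (fun s => 1 + c * s) = 1 + PowerSeries.C c * PowerSeries.X := by
  ext k
  simp only [taylor, PowerSeries.coeff_mk]
  have hd : deriv (fun s : ℂ => 1 + c * s) = fun _ => c := by
    funext s
    simp
  rcases k with _ | _ | k
  · simp
  · simp [iteratedDeriv_one, hd, PowerSeries.coeff_one]
  · rw [iteratedDeriv_succ', hd, iteratedDeriv_const]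
    simp [PowerSeries.coeff_one]

theorem eventually_one_add_mul_mem (c : ℂ) :
    ∀ᶠ s : ℂ in nhds 0, 1 + c * s ∈ Complex.slitPlane := by
  have h : ContinuousAt (fun s : ℂ => 1 + c * s) 0 := by fun_prop
  exact h.eventually_mem (Complex.isOpen_slitPlane.mem_nhds (by simp))

theorem analyticAt_zpow (c : ℂ) (n : ℤ) : AnalyticAt ℂ (fun s : ℂ => (1 + c * s) ^ n) 0 :=
  AnalyticAt.fun_zpow (by fun_prop) (by simp)

theorem analyticAt_cpow (z : ℂ) : AnalyticAt ℂ (fun s : ℂ => (1 + s) ^ z) 0 :=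
  AnalyticAt.cpow (by fun_prop) analyticAt_const (by simp)

/-- Source of all polynomiality in (n,m): the derivatives are c^k times falling factorials of n, for
negative n as well. -/
theorem exists_iteratedDeriv_zpow_eq_eval (c : ℂ) (k : ℕ) : ∃ p : Polynomial ℂ, ∀ n : ℤ,
    iteratedDeriv k (fun s : ℂ => (1 + c * s) ^ n) 0 = p.eval (n : ℂ) := by
  induction k with
  | zero => exact ⟨1, by simp⟩
  | succ k ih =>
    obtain ⟨p, hp⟩ := ih
    refine ⟨Polynomial.C c * Polynomial.X * p.comp (Polynomial.X - 1), fun n => ?_⟩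
    have hd : deriv (fun s : ℂ => (1 + c * s) ^ n) =ᶠ[nhds 0]
        fun s => (c * n) * (1 + c * s) ^ (n - 1) := by
      filter_upwards [eventually_one_add_mul_mem c] with s hs
      have h1 : HasDerivAt (fun s : ℂ => 1 + c * s) c s := by
        simpa using ((hasDerivAt_id s).const_mul c).const_add 1
      have h2 := (hasDerivAt_zpow n (1 + c * s) (Or.inl (Complex.slitPlane_ne_zero hs))).comp s h1
      rw [show (fun s : ℂ => (1 + c * s) ^ n) = (fun x : ℂ => x ^ n) ∘ fun s => 1 + c * s from rfl,
        h2.deriv]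
      ring
    rw [iteratedDeriv_succ', hd.iteratedDeriv_eq, iteratedDeriv_const_mul_field, hp]
    simp [Polynomial.eval_comp]

/-- The generating function at `l = 0` without antisymmetrization. -/
def gen (a b l₀ : ℂ) (n m : ℤ) (s : ℂ) : ℂ :=
  (1 + s) ^ l₀ * ((1 + a * s) ^ n * (1 + b * s) ^ m)

theorem analyticAt_gen (a b l₀ : ℂ) (n m : ℤ) : AnalyticAt ℂ (gen a b l₀ n m) 0 :=
  (analyticAt_cpow l₀).mul ((analyticAt_zpow a n).fun_mul (analyticAt_zpow b m))

/-- The Taylor series of the generating function. -/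
def ser (a b l₀ : ℂ) (n m : ℤ) : PowerSeries ℂ := taylor (gen a b l₀ n m)

theorem coeff_zero_ser (a b l₀ : ℂ) (n m : ℤ) : PowerSeries.coeff 0 (ser a b l₀ n m) = 1 := by
  simp [ser, taylor, gen]

theorem isPoly_coeff_ser (a b l₀ : ℂ) (k : ℕ) :
    IsPoly fun n m => PowerSeries.coeff k (ser a b l₀ n m) := by
  have h : ∀ n m, ser a b l₀ n m = taylor (fun s => (1 + s) ^ l₀) *
      (taylor (fun s => (1 + a * s) ^ n) * taylor (fun s => (1 + b * s) ^ m)) := fun n m => by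
    rw [← taylor_mul (analyticAt_zpow a n) (analyticAt_zpow b m),
      ← taylor_mul (analyticAt_cpow l₀) ((analyticAt_zpow a n).fun_mul (analyticAt_zpow b m))]
    rfl
  choose pa hpa using exists_iteratedDeriv_zpow_eq_eval a
  choose pb hpb using exists_iteratedDeriv_zpow_eq_eval b
  simp only [h, PowerSeries.coeff_mul, taylor, PowerSeries.coeff_mk, hpa, hpb, div_eq_mul_inv]
  exact IsPoly.sum _ fun _ => (IsPoly.const _).mul (IsPoly.sum _ fun _ =>
    ((IsPoly.fst _).mul (IsPoly.const _)).mul ((IsPoly.snd _).mul (IsPoly.const _)))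

theorem ser_succ_left (a b l₀ : ℂ) (n m : ℤ) :
    ser a b l₀ (n + 1) m = (1 + PowerSeries.C a * PowerSeries.X) * ser a b l₀ n m := by
  rw [← taylor_linear, ser, ser, ← taylor_mul (by fun_prop) (analyticAt_gen a b l₀ n m)]
  refine taylor_congr ?_
  filter_upwards [eventually_one_add_mul_mem a] with s hs
  simp only [gen, zpow_add_one₀ (Complex.slitPlane_ne_zero hs)]
  ring

theorem ser_succ_right (a b l₀ : ℂ) (n m : ℤ) :
    ser a b l₀ n (m + 1) = (1 + PowerSeries.C b * PowerSeries.X) * ser a b l₀ n m := by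
  rw [← taylor_linear, ser, ser, ← taylor_mul (by fun_prop) (analyticAt_gen a b l₀ n m)]
  refine taylor_congr ?_
  filter_upwards [eventually_one_add_mul_mem b] with s hs
  simp only [gen, zpow_add_one₀ (Complex.slitPlane_ne_zero hs)]
  ring

theorem taylor_one_add_pow_mul {g : ℂ → ℂ} (hg : AnalyticAt ℂ g 0) (l : ℕ) :
    taylor (fun s => (1 + s) ^ l * g s) = (1 + PowerSeries.X) ^ l * taylor g := by
  induction l with
  | zero => simp
  | succ l ih =>
    have h : (fun s => (1 + s) ^ (l + 1) * g s) = fun s => (1 + 1 * s) * ((1 + s) ^ l * g s) := by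
      funext s
      ring
    rw [h, taylor_mul (by fun_prop) (AnalyticAt.fun_mul (by fun_prop) hg), ih, taylor_linear, pow_succ']
    simp [mul_assoc]

/-- Near 0, ψ is the odd part of a single function g, so its odd Taylor coefficients are those of g.
-/
theorem alpha_eq_coeff (a b l₀ : ℂ) (n m : ℤ) (l j : ℕ) :
    alpha a b l₀ n m l j =
      PowerSeries.coeff (2 * j + 1) ((1 + PowerSeries.X) ^ l * ser a b l₀ n m) := by
  rw [ser, ← taylor_one_add_pow_mul (analyticAt_gen a b l₀ n m)]
  set g : ℂ → ℂ := fun s => (1 + s) ^ l * gen a b l₀ n m s with hg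
  have hga : AnalyticAt ℂ g 0 :=
    (by fun_prop : AnalyticAt ℂ (fun s : ℂ => (1 + s) ^ l) 0).mul (analyticAt_gen a b l₀ n m)
  have hgn : AnalyticAt ℂ (fun s => g (-s)) 0 :=
    AnalyticAt.fun_comp (g := g) (by simpa using hga) (by fun_prop)
  have hcpow : ∀ᶠ s : ℂ in nhds 0, (1 + s) ^ ((l : ℂ) + l₀) = (1 + s) ^ l * (1 + s) ^ l₀ := by
    filter_upwards [eventually_one_add_mul_mem 1] with s hs
    rw [one_mul] at hs
    rw [Complex.cpow_add _ _ (Complex.slitPlane_ne_zero hs), Complex.cpow_natCast]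
  have hcpow' : ∀ᶠ s : ℂ in nhds 0,
      (1 - s) ^ ((l : ℂ) + l₀) = (1 - s) ^ l * (1 - s) ^ l₀ := by
    filter_upwards [eventually_one_add_mul_mem (-1)] with s hs
    rw [neg_one_mul, ← sub_eq_add_neg] at hs
    rw [Complex.cpow_add _ _ (Complex.slitPlane_ne_zero hs), Complex.cpow_natCast]
  have hpsi : psi a b l₀ n m l =ᶠ[nhds 0] fun s => (1 / 2) * (g s - g (-s)) := by
    filter_upwards [hcpow, hcpow'] with s h1 h2
    simp only [psi, hg, gen, h1, h2, mul_neg, ← sub_eq_add_neg]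
    ring
  rw [alpha, hpsi.iteratedDeriv_eq, iteratedDeriv_const_mul_field,
    iteratedDeriv_fun_sub hga.contDiffAt hgn.contDiffAt, iteratedDeriv_comp_neg]
  simp only [taylor, PowerSeries.coeff_mk, neg_zero, smul_eq_mul, pow_succ, pow_mul]
  simp
  ring

/-! ### Tau functions and their bilinear edge relation. -/

/-- The functional `P ↦ [s^(2 i + 1)] (P(s) E(s))`. -/
def oddCoeff (E : PowerSeries ℂ) (i : ℕ) : Polynomial ℂ →ₗ[ℂ] ℂ where
  toFun P := PowerSeries.coeff (2 * i + 1) ((P : PowerSeries ℂ) * E)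
  map_add' P Q := by simp [add_mul]
  map_smul' c P := by
    rw [Polynomial.smul_eq_C_mul, Polynomial.coe_mul, Polynomial.coe_C, mul_assoc]
    simp

/-- The staircase Jacobi–Trudi determinant of the coefficients of `E`. -/
def tau (E : PowerSeries ℂ) (N : ℕ) : ℂ :=
  (Matrix.of fun i j : Fin N => oddCoeff E i (Polynomial.X ^ (j : ℕ))).det

theorem tau_zero (E : PowerSeries ℂ) : tau E 0 = 1 := by simp [tau]

theorem oddCoeff_succ_X_sq_mul (E : PowerSeries ℂ) (i : ℕ) (P : Polynomial ℂ) :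
    oddCoeff E (i + 1) (Polynomial.X ^ 2 * P) = oddCoeff E i P := by
  simp only [oddCoeff, LinearMap.coe_mk, AddHom.coe_mk, Polynomial.coe_mul, Polynomial.coe_pow,
    Polynomial.coe_X, mul_assoc]
  rw [show 2 * (i + 1) + 1 = 2 * i + 1 + 2 by ring, PowerSeries.coeff_X_pow_mul]

theorem oddCoeff_zero (E : PowerSeries ℂ) (P : Polynomial ℂ) :
    oddCoeff E 0 P = P.coeff 0 * PowerSeries.coeff 1 E + P.coeff 1 * PowerSeries.coeff 0 E := by
  simp [oddCoeff, PowerSeries.coeff_mul, Finset.Nat.antidiagonal_succ]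

/-- Lets a lattice step act on the polynomial instead of the series. -/
theorem oddCoeff_linear_mul (E : PowerSeries ℂ) (a : ℂ) (i : ℕ) (P : Polynomial ℂ) :
    oddCoeff ((1 + PowerSeries.C a * PowerSeries.X) * E) i P =
      oddCoeff E i ((1 + Polynomial.C a * Polynomial.X) * P) := by
  simp only [oddCoeff, LinearMap.coe_mk, AddHom.coe_mk, Polynomial.coe_mul, Polynomial.coe_add,
    Polynomial.coe_one, Polynomial.coe_C, Polynomial.coe_X]
  congr 1
  ring

/-- A polynomial annihilated by all but one of the functionals evaluates their determinant on the
monomials. -/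
theorem coeff_mul_det_functionals {N : ℕ} (L : Fin (N + 1) → Polynomial ℂ →ₗ[ℂ] ℂ)
    {S : Polynomial ℂ} (hS : S.natDegree ≤ N) (k : Fin (N + 1)) (h : ∀ i, i ≠ k → L i S = 0) :
    S.coeff N * (Matrix.of fun i j : Fin (N + 1) => L i (Polynomial.X ^ (j : ℕ))).det =
      (-1) ^ ((k : ℕ) + N) * L k S *
        (Matrix.of fun i j : Fin N => L (k.succAbove i) (Polynomial.X ^ (j : ℕ))).det := by
  set A := Matrix.of fun i j : Fin (N + 1) => L i (Polynomial.X ^ (j : ℕ)) with hA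
  have hsum : ∀ i, ∑ j : Fin (N + 1), S.coeff j * A i j = L i S := fun i => by
    conv_rhs => rw [S.as_sum_range_C_mul_X_pow' (Nat.lt_succ_of_le hS)]
    rw [map_sum, Finset.sum_range]
    simp [hA, ← Polynomial.smul_eq_C_mul]
  -- Cramer's rule: replacing the last column by the combination of columns with the coefficients of
  -- S multiplies the determinant by `S.coeff N` and leaves one nonzero entry in that column.
  have h1 := A.det_updateCol_sum (Fin.last N) fun j => S.coeff j
  simp only [Fin.val_last, smul_eq_mul, hsum] at h1
  simp only [← h1]
  rw [Matrix.det_succ_column _ (Fin.last N), Finset.sum_eq_single k]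
  · simp only [Matrix.updateCol_self, Fin.val_last]
    congr 1
    congr 1
    ext i j
    simp [hA, (Fin.castSucc_lt_last j).ne]
  · intro i _ hi
    simp [h i hi]
  · simp

theorem coeff_mul_tau_succ (E : PowerSeries ℂ) {N : ℕ} {S : Polynomial ℂ} (hS : S.natDegree ≤ N)
    (h : ∀ i < N, oddCoeff E i S = 0) : S.coeff N * tau E (N + 1) = oddCoeff E N S * tau E N := by
  have h1 := coeff_mul_det_functionals (fun i : Fin (N + 1) => oddCoeff E i) hS (Fin.last N)
    fun i hi => h i (Fin.val_lt_last hi)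
  simpa [tau, ← two_mul] using h1

theorem det_of_row_zero {n : ℕ} {A : Matrix (Fin (n + 1)) (Fin (n + 1)) ℂ}
    (h : ∀ j, A 0 j = if j = 0 then 1 else 0) : A.det = (A.submatrix Fin.succ Fin.succ).det := by
  rw [Matrix.det_succ_row_zero, Finset.sum_eq_single 0]
  · simp [h]
  · intro j _ hj
    simp [h, hj]
  · simp

/-- The constant-coefficient functional is put in front of the odd ones. The first two rows are then
stripped off one after the other, and invariance under (i, j) ↦ (i+1, j+2) identifies the rest with
`tau E N`. -/
theorem coeff_mul_tau_pred {E : PowerSeries ℂ} (hE : PowerSeries.coeff 0 E = 1) {N : ℕ}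
    {S : Polynomial ℂ} (hS : S.natDegree ≤ N + 1) (h : ∀ i < N + 1, oddCoeff E i S = 0) :
    S.coeff (N + 1) * tau E N = (-1) ^ (N + 1) * S.coeff 0 * tau E (N + 1) := by
  obtain ⟨L, hL0, hLs⟩ : ∃ L : Fin (N + 2) → Polynomial ℂ →ₗ[ℂ] ℂ,
      L 0 = Polynomial.lcoeff ℂ 0 ∧ ∀ i : Fin (N + 1), L i.succ = oddCoeff E i :=
    ⟨Fin.cons (Polynomial.lcoeff ℂ 0) fun i => oddCoeff E i, rfl, fun _ => rfl⟩
  have h1 := coeff_mul_det_functionals L hS 0 fun i hi => by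
    obtain ⟨j, rfl⟩ := Fin.exists_succ_eq.2 hi
    simpa [hLs] using h j j.2
  rw [det_of_row_zero, det_of_row_zero] at h1
  rotate_left
  · intro j
    have hL1 : L 1 = oddCoeff E 0 := hLs 0
    rw [PowerSeries.coeff_zero_eq_constantCoeff] at hE
    refine Fin.cases ?_ (fun i => ?_) j
    · simp [hL1, oddCoeff_zero, hE]
    · simp [hL1, oddCoeff_zero, Polynomial.coeff_X_pow]
  · intro j
    refine Fin.cases ?_ (fun i => ?_) j
    · simp [hL0]
    · simp [hL0, Polynomial.coeff_X_pow]
  have h2 : ((Matrix.of fun i j : Fin (N + 2) => L i (Polynomial.X ^ (j : ℕ))).submatrix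
        Fin.succ Fin.succ).submatrix Fin.succ Fin.succ =
      Matrix.of fun i j : Fin N => oddCoeff E i (Polynomial.X ^ (j : ℕ)) := by
    ext i j
    simp [hLs, ← oddCoeff_succ_X_sq_mul E i, ← pow_add, add_comm 2, add_assoc]
  rw [h2] at h1
  simpa [tau, hL0, hLs] using h1

/-- The lower coefficients solve a linear system whose determinant is `tau E N`. -/
theorem exists_monic_oddCoeff_eq_zero {E : PowerSeries ℂ} {N : ℕ} (h : tau E N ≠ 0) :
    ∃ P : Polynomial ℂ, P.natDegree ≤ N ∧ P.coeff N = 1 ∧ ∀ i < N, oddCoeff E i P = 0 := by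
  set A := Matrix.of fun i j : Fin N => oddCoeff E i (Polynomial.X ^ (j : ℕ)) with hA
  set c := A⁻¹.mulVec fun i => oddCoeff E i (Polynomial.X ^ N) with hc
  have hAc : A.mulVec c = fun i : Fin N => oddCoeff E i (Polynomial.X ^ N) := by
    rw [hc, Matrix.mulVec_mulVec, Matrix.mul_nonsing_inv _ (Ne.isUnit h), Matrix.one_mulVec]
  set Q : Polynomial ℂ := ∑ j : Fin N, Polynomial.C (c j) * Polynomial.X ^ (j : ℕ) with hQ
  have hQdeg : Q.degree < N := (Polynomial.degree_sum_le _ _).trans_lt <|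
    (Finset.sup_lt_iff (WithBot.bot_lt_coe N)).2 fun j _ =>
      (Polynomial.degree_C_mul_X_pow_le _ _).trans_lt (Nat.cast_lt.2 j.2)
  refine ⟨Polynomial.X ^ N - Q, ?_, ?_, fun i hi => ?_⟩
  · simpa using Polynomial.natDegree_sub_le_of_le (Polynomial.natDegree_X_pow_le (R := ℂ) N)
      (Polynomial.natDegree_le_of_degree_le hQdeg.le)
  · simp [Polynomial.coeff_eq_zero_of_degree_lt hQdeg]
  · have h1 := congrFun hAc ⟨i, hi⟩
    simp only [Matrix.mulVec, dotProduct, hA, Matrix.of_apply] at h1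
    rw [map_sub, ← h1, hQ, map_sum, sub_eq_zero]
    refine Finset.sum_congr rfl fun j _ => ?_
    rw [← Polynomial.smul_eq_C_mul, map_smul, smul_eq_mul, mul_comm]

theorem tau_bilinear_of_ne_zero {E : PowerSeries ℂ} (hE : PowerSeries.coeff 0 E = 1) (a : ℂ)
    {k : ℕ} (h0 : tau E k ≠ 0) (h1 : tau E (k + 1) ≠ 0)
    (h2 : tau ((1 + PowerSeries.C a * PowerSeries.X) * E) (k + 1) ≠ 0) :
    tau ((1 + PowerSeries.C a * PowerSeries.X) * E) (k + 2) * tau E k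
      - tau E (k + 2) * tau ((1 + PowerSeries.C a * PowerSeries.X) * E) k =
    a * tau E (k + 1) * tau ((1 + PowerSeries.C a * PowerSeries.X) * E) (k + 1) := by
  set E' := (1 + PowerSeries.C a * PowerSeries.X) * E with hE'
  have hE0 : PowerSeries.coeff 0 E' = 1 := by
    simpa [hE'] using hE
  obtain ⟨P, hPd, hPc, hP⟩ := exists_monic_oddCoeff_eq_zero h1
  obtain ⟨P', hPd', hPc', hP'⟩ := exists_monic_oddCoeff_eq_zero h2
  have e1 := coeff_mul_tau_succ E hPd hP
  have e2 := coeff_mul_tau_succ E' hPd' hP'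
  have e3 := coeff_mul_tau_pred hE hPd hP
  have e4 := coeff_mul_tau_pred hE0 hPd' hP'
  rw [hPc, one_mul] at e1 e3
  rw [hPc', one_mul] at e2 e4
  -- Both (1+aX)P' and P are annihilated by the first k+1 functionals of E. The combination Q also
  -- has no constant term, and the functional of index 0 then kills its linear term. So S = Q/X² is
  -- annihilated by the first k functionals and has degree at most k, which determines the next
  -- functional's value on it.
  set Q : Polynomial ℂ := Polynomial.C (P.coeff 0) * ((1 + Polynomial.C a * Polynomial.X) * P')
    - Polynomial.C (P'.coeff 0) * P with hQ
  have hLQ : ∀ i, oddCoeff E i Q = P.coeff 0 * oddCoeff E' i P' - P'.coeff 0 * oddCoeff E i P := by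
    intro i
    rw [hQ, map_sub, ← Polynomial.smul_eq_C_mul (P.coeff 0),
      ← Polynomial.smul_eq_C_mul (P'.coeff 0), map_smul, map_smul, ← oddCoeff_linear_mul, smul_eq_mul, smul_eq_mul]
  have hLQ0 : ∀ i < k + 1, oddCoeff E i Q = 0 := fun i hi => by
    rw [hLQ, hP i hi, hP' i hi, mul_zero, mul_zero, sub_zero]
  have hQ0 : Q.coeff 0 = 0 := by
    rw [hQ]
    simp [Polynomial.mul_coeff_zero, mul_comm (P.coeff 0)]
  have hQ1 : Q.coeff 1 = 0 := by
    have := hLQ0 0 k.succ_pos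
    rwa [oddCoeff_zero, hQ0, zero_mul, zero_add, hE, mul_one] at this
  obtain ⟨S, hS⟩ : Polynomial.X ^ 2 ∣ Q := Polynomial.X_pow_dvd_iff.2 fun d hd => by
    interval_cases d <;> assumption
  have hcS : ∀ d, S.coeff d = Q.coeff (d + 2) := fun d => by
    rw [hS, Polynomial.coeff_X_pow_mul]
  have hcQ : ∀ d, Q.coeff (d + 1) = P.coeff 0 * (P'.coeff (d + 1) + a * P'.coeff d)
      - P'.coeff 0 * P.coeff (d + 1) := fun d => by
    rw [hQ, add_mul, one_mul, mul_assoc, Polynomial.coeff_sub, Polynomial.coeff_C_mul,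
      Polynomial.coeff_C_mul, Polynomial.coeff_add, Polynomial.coeff_C_mul,
      Polynomial.coeff_X_mul]
  have hS1 : S.natDegree ≤ k := Polynomial.natDegree_le_iff_coeff_eq_zero.2 fun d hd => by
    rw [hcS, hcQ, P.coeff_eq_zero_of_natDegree_lt (n := d + 1 + 1) (by omega),
      P'.coeff_eq_zero_of_natDegree_lt (n := d + 1 + 1) (by omega),
      P'.coeff_eq_zero_of_natDegree_lt (n := d + 1) (by omega)]
    ring
  have hSk : S.coeff k = a * P.coeff 0 := by
    rw [hcS, hcQ, hPc', P.coeff_eq_zero_of_natDegree_lt (n := k + 1 + 1) (by omega),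
      P'.coeff_eq_zero_of_natDegree_lt (n := k + 1 + 1) (by omega)]
    ring
  have hLS : ∀ i, oddCoeff E i S = oddCoeff E (i + 1) Q := fun i => by
    rw [hS, oddCoeff_succ_X_sq_mul]
  have e5 := coeff_mul_tau_succ E hS1 fun i hi => by rw [hLS, hLQ0 _ (by omega)]
  rw [hLS, hLQ, hSk] at e5
  have hsq : ((-1 : ℂ) ^ (k + 1)) * (-1) ^ (k + 1) = 1 := by
    rw [← mul_pow]
    simp
  have e6 : (-1) ^ (k + 1) *
      (P.coeff 0 * oddCoeff E' (k + 1) P' - P'.coeff 0 * oddCoeff E (k + 1) P) = a := by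
    refine mul_right_cancel₀ h0 ?_
    linear_combination -(-1) ^ (k + 1) * e5 - a * e3
  rw [show k + 2 = k + 1 + 1 from rfl, e1, e2, e3, e4]
  linear_combination tau E (k + 1) * tau E' (k + 1) * e6

theorem tau_one (E : PowerSeries ℂ) : tau E 1 = PowerSeries.coeff 1 E := by
  simp [tau, oddCoeff_zero, Polynomial.coeff_one]

/-! ### Casoratians as tau functions on the lattice, and their generic nonvanishing. -/

theorem casoratian_eq_tau (a b l₀ : ℂ) (N : ℕ) (n m : ℤ) :
    casoratian a b l₀ N n m = tau (ser a b l₀ n m) N := by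
  -- Binomial matrix expressing (1+X)^l in monomials; it is upper unitriangular.
  set T : Matrix (Fin N) (Fin N) ℂ :=
    Matrix.of fun j l => ((1 + Polynomial.X : Polynomial ℂ) ^ (l : ℕ)).coeff j with hT
  have hTdet : T.det = 1 := by
    have htri : T.BlockTriangular id := fun j l hjl => by
      simpa [hT, Polynomial.coeff_one_add_X_pow] using Nat.choose_eq_zero_of_lt hjl
    rw [Matrix.det_of_isUpperTriangular htri]
    simp [hT, Polynomial.coeff_one_add_X_pow]
  rw [casoratian, tau, ← mul_one (Matrix.det (Matrix.of fun i j : Fin N =>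
    oddCoeff (ser a b l₀ n m) i (Polynomial.X ^ (j : ℕ)))), ← hTdet, ← Matrix.det_mul]
  congr 1
  ext i l
  have hdeg : ((1 + Polynomial.X : Polynomial ℂ) ^ (l : ℕ)).natDegree < N := by
    refine lt_of_le_of_lt ?_ l.2
    rw [add_comm, ← Polynomial.C_1]
    simpa using Polynomial.natDegree_pow_le_of_le (l : ℕ) (Polynomial.natDegree_X_add_C (1 : ℂ)).le
  have h1 : alpha a b l₀ n m l i =
      oddCoeff (ser a b l₀ n m) i ((1 + Polynomial.X : Polynomial ℂ) ^ (l : ℕ)) := by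
    rw [alpha_eq_coeff]
    simp [oddCoeff]
  rw [Matrix.of_apply, h1, Polynomial.as_sum_range_C_mul_X_pow' _ hdeg, map_sum, Finset.sum_range,
    Matrix.mul_apply]
  refine Finset.sum_congr rfl fun j _ => ?_
  rw [← Polynomial.smul_eq_C_mul, map_smul, smul_eq_mul, mul_comm]
  rfl

theorem isPoly_tau (a b l₀ : ℂ) (N : ℕ) : IsPoly fun n m => tau (ser a b l₀ n m) N := by
  refine IsPoly.det fun i j => ?_
  simp only [oddCoeff, LinearMap.coe_mk, AddHom.coe_mk, Polynomial.coe_pow, Polynomial.coe_X,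
    PowerSeries.coeff_X_pow_mul']
  split_ifs
  · exact isPoly_coeff_ser a b l₀ _
  · exact IsPoly.const 0

theorem tau_bilinear_of_shift {a b l₀ c : ℂ} {k l : ℤ}
    (hs : ∀ n m, ser a b l₀ (n + k) (m + l) =
      (1 + PowerSeries.C c * PowerSeries.X) * ser a b l₀ n m) {N : ℕ}
    (h0 : ∃ n m, tau (ser a b l₀ n m) N ≠ 0) (h1 : ∃ n m, tau (ser a b l₀ n m) (N + 1) ≠ 0)
    (n m : ℤ) :
    tau (ser a b l₀ (n + k) (m + l)) (N + 2) * tau (ser a b l₀ n m) N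
      - tau (ser a b l₀ n m) (N + 2) * tau (ser a b l₀ (n + k) (m + l)) N =
    c * tau (ser a b l₀ n m) (N + 1) * tau (ser a b l₀ (n + k) (m + l)) (N + 1) := by
  have hp := isPoly_tau a b l₀
  have h1' : ∃ n m, tau (ser a b l₀ (n + k) (m + l)) (N + 1) ≠ 0 := by
    obtain ⟨n, m, h⟩ := h1
    exact ⟨n - k, m - l, by simpa using h⟩
  refine sub_eq_zero.1 (IsPoly.cancel ((hp N).mul ((hp (N + 1)).mul ((hp (N + 1)).shift k l)))
    (((((hp (N + 2)).shift k l).mul (hp N)).sub ((hp (N + 2)).mul ((hp N).shift k l))).sub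
      (((IsPoly.const c).mul (hp (N + 1))).mul ((hp (N + 1)).shift k l)))
    (IsPoly.mul_ne_zero (hp N) ((hp (N + 1)).mul ((hp (N + 1)).shift k l)) h0
      (IsPoly.mul_ne_zero (hp (N + 1)) ((hp (N + 1)).shift k l) h1 h1'))
    (fun n m h => ?_) n m)
  obtain ⟨h2, h3⟩ := mul_ne_zero_iff.1 h
  obtain ⟨h3, h4⟩ := mul_ne_zero_iff.1 h3
  rw [hs] at h4
  rw [sub_eq_zero]
  simp only [hs]
  exact tau_bilinear_of_ne_zero (coeff_zero_ser a b l₀ n m) c h2 h3 h4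

theorem tau_one_succ_left (a b l₀ : ℂ) (n m : ℤ) :
    tau (ser a b l₀ (n + 1) m) 1 = tau (ser a b l₀ n m) 1 + a := by
  have h := coeff_zero_ser a b l₀ n m
  rw [PowerSeries.coeff_zero_eq_constantCoeff] at h
  simp [tau_one, ser_succ_left, add_mul, mul_assoc, h, PowerSeries.coeff_succ_X_mul 0]

theorem tau_one_succ_right (a b l₀ : ℂ) (n m : ℤ) :
    tau (ser a b l₀ n (m + 1)) 1 = tau (ser a b l₀ n m) 1 + b := by
  have h := coeff_zero_ser a b l₀ n m
  rw [PowerSeries.coeff_zero_eq_constantCoeff] at h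
  simp [tau_one, ser_succ_right, add_mul, mul_assoc, h, PowerSeries.coeff_succ_X_mul 0]

/-- If the tau function of order N+2 vanished identically, the edge relation would make a product of
two nonzero polynomial functions of order N+1 vanish. -/
theorem exists_tau_ne_zero {a : ℂ} (ha : a ≠ 0) (b l₀ : ℂ) (N : ℕ) :
    (∃ n m, tau (ser a b l₀ n m) N ≠ 0) ∧ ∃ n m, tau (ser a b l₀ n m) (N + 1) ≠ 0 := by
  induction N with
  | zero =>
    refine ⟨⟨0, 0, by simp [tau_zero]⟩, ?_⟩
    by_contra! h
    have := tau_one_succ_left a b l₀ 0 0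
    rw [h, h, zero_add] at this
    exact ha this.symm
  | succ N ih =>
    refine ⟨ih.2, ?_⟩
    by_contra! h
    have hR := tau_bilinear_of_shift (k := 1) (l := 0)
      (fun n m => by rw [add_zero, ser_succ_left]) ih.1 ih.2
    have hp := isPoly_tau a b l₀ (N + 1)
    have h1 : ∃ n m, tau (ser a b l₀ (n + 1) (m + 0)) (N + 1) ≠ 0 := by
      obtain ⟨n, m, h⟩ := ih.2
      exact ⟨n - 1, m, by simpa using h⟩
    obtain ⟨n, m, h2⟩ := IsPoly.mul_ne_zero hp (hp.shift 1 0) ih.2 h1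
    have h3 := hR n m
    rw [h, h, zero_mul, zero_mul, sub_zero, mul_assoc] at h3
    exact mul_ne_zero ha h2 h3.symm

/-! ### Bilinear relations on elementary squares. -/

/-- The bilinear relations on lattice edges between three consecutive tau functions. -/
structure EdgeTriple (a b : ℂ) (Y F X : ℤ → ℤ → ℂ) : Prop where
  left : ∀ n m, X (n + 1) m * Y n m - X n m * Y (n + 1) m = a * F n m * F (n + 1) m
  right : ∀ n m, X n (m + 1) * Y n m - X n m * Y n (m + 1) = b * F n m * F n (m + 1)

/-- The bilinear relations on elementary squares between two consecutive tau functions. -/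
structure SquarePair (a b : ℂ) (F X : ℤ → ℤ → ℂ) : Prop where
  upper : ∀ n m, a * X (n + 1) m * F n (m + 1) - b * X n (m + 1) * F (n + 1) m =
    (a - b) * F n m * X (n + 1) (m + 1)
  lower : ∀ n m, a * X n (m + 1) * F (n + 1) m - b * X (n + 1) m * F n (m + 1) =
    (a - b) * F (n + 1) (m + 1) * X n m

/-- The bilinear relations on the diagonals of elementary squares between three consecutive tau
functions. -/
structure SquareTriple (a b : ℂ) (Y F X : ℤ → ℤ → ℂ) : Prop where
  anti : ∀ n m, X (n + 1) m * Y n (m + 1) - X n (m + 1) * Y (n + 1) m =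
    (a - b) * F n m * F (n + 1) (m + 1)
  diag : ∀ n m, X (n + 1) (m + 1) * Y n m - X n m * Y (n + 1) (m + 1) =
    (a + b) * F (n + 1) m * F n (m + 1)

/-- Exchanging the outer functions changes the sign of the left side; the opposite signs -ε and ε
restore it. This serves the passage to negative orders. -/
theorem EdgeTriple.reverse {a b : ℂ} {Y F X : ℤ → ℤ → ℂ} (h : EdgeTriple a b Y F X) {ε ε' : ℂ}
    (hε : ε * ε = 1) (hε' : ε' * ε' = 1) : EdgeTriple a b (fun n m => -ε * X n m)
      (fun n m => ε' * F n m) fun n m => ε * Y n m where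
  left n m := by
    linear_combination ε * ε * h.left n m +
      a * F n m * F (n + 1) m * (hε - hε')
  right n m := by
    linear_combination ε * ε * h.right n m +
      b * F n m * F n (m + 1) * (hε - hε')

theorem SquareTriple.reverse {a b : ℂ} {Y F X : ℤ → ℤ → ℂ} (h : SquareTriple a b Y F X) {ε ε' : ℂ}
    (hε : ε * ε = 1) (hε' : ε' * ε' = 1) : SquareTriple a b (fun n m => -ε * X n m)
      (fun n m => ε' * F n m) fun n m => ε * Y n m where
  anti n m := by
    linear_combination ε * ε * h.anti n m +
      (a - b) * F n m * F (n + 1) (m + 1) * (hε - hε')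
  diag n m := by
    linear_combination ε * ε * h.diag n m +
      (a + b) * F (n + 1) m * F n (m + 1) * (hε - hε')

theorem SquarePair.reverse {a b : ℂ} {F X : ℤ → ℤ → ℂ} (h : SquarePair a b F X) (ε ε' : ℂ) :
    SquarePair a b (fun n m => ε * X n m) fun n m => ε' * F n m where
  upper n m := by linear_combination ε * ε' * h.lower n m
  lower n m := by linear_combination ε * ε' * h.upper n m

theorem IsPoly.eq_of_mul {F G H : ℤ → ℤ → ℂ} (hF : IsPoly F) (hG : IsPoly G) (hH : IsPoly H)
    (h0 : ∃ n m, F n m ≠ 0) (h : ∀ n m, F n m * (G n m - H n m) = 0) (n m : ℤ) :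
    G n m = H n m :=
  sub_eq_zero.1 (IsPoly.cancel hF (hG.sub hH) h0
    (fun n m h1 => (mul_eq_zero.1 (h n m)).resolve_left h1) n m)

theorem IsPoly.left {F : ℤ → ℤ → ℂ} (hF : IsPoly F) : IsPoly fun n m => F (n + 1) m := by
  simpa using hF.shift 1 0

theorem IsPoly.right {F : ℤ → ℤ → ℂ} (hF : IsPoly F) : IsPoly fun n m => F n (m + 1) := by
  simpa using hF.shift 0 1

theorem SquarePair.squareTriple {a b : ℂ} (hab : a ≠ b) {F X Z : ℤ → ℤ → ℂ}
    (h : SquarePair a b F X) (hR : EdgeTriple a b F X Z) (hF : IsPoly F) (hX : IsPoly X)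
    (hZ : IsPoly Z) (h0 : ∃ n m, F n m ≠ 0) : SquareTriple a b F X Z where
  anti := by
    refine IsPoly.eq_of_mul hF ((hZ.left.mul hF.right).sub (hZ.right.mul hF.left))
      (((IsPoly.const _).mul hX).mul hX.left.right) h0 fun n m => ?_
    linear_combination F n (m + 1) * hR.left n m - F (n + 1) m * hR.right n m + X n m * h.upper n m
  diag := by
    have h0' : ∃ n m, F n (m + 1) ≠ 0 := by
      obtain ⟨n, m, h1⟩ := h0
      exact ⟨n, m - 1, by simpa using h1⟩
    refine IsPoly.eq_of_mul hF.right ((hZ.left.right.mul hF).sub (hZ.mul hF.left.right))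
      (((IsPoly.const _).mul hX.left).mul hX.right) h0' fun n m => ?_
    refine mul_left_cancel₀ (sub_ne_zero.2 hab) ?_
    linear_combination (a - b) * F n m * hR.left n (m + 1)
      + (a - b) * F (n + 1) (m + 1) * hR.right n m
      - a * X n (m + 1) * h.upper n m - b * X n (m + 1) * h.lower n m

/-- Induction step in the order: each relation for (X, Z), multiplied by F, is a combination of
known relations, and F cancels because polynomial functions have no zero divisors. -/
theorem SquarePair.succ {a b : ℂ} {F X Z : ℤ → ℤ → ℂ}
    (h : SquarePair a b F X) (hR : EdgeTriple a b F X Z) (hS : SquareTriple a b F X Z)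
    (hF : IsPoly F) (hX : IsPoly X)
    (hZ : IsPoly Z) (h0 : ∃ n m, F n m ≠ 0) : SquarePair a b X Z where
  upper := by
    refine IsPoly.eq_of_mul hF ((((IsPoly.const _).mul hZ.left).mul hX.right).sub
      (((IsPoly.const _).mul hZ.right).mul hX.left))
      (((IsPoly.const _).mul hX).mul hZ.left.right) h0 fun n m => ?_
    linear_combination a * X n (m + 1) * hR.left n m - b * X (n + 1) m * hR.right n m
      - (a - b) * X n m * hS.diag n m + Z n m * h.lower n m
  lower := by
    refine IsPoly.eq_of_mul hF ((((IsPoly.const _).mul hZ.right).mul hX.left).sub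
      (((IsPoly.const _).mul hZ.left).mul hX.right))
      (((IsPoly.const _).mul hX.left.right).mul hZ) h0 fun n m => ?_
    linear_combination a * X (n + 1) m * hR.right n m - b * X n (m + 1) * hR.left n m
      + Z n m * h.upper n m

theorem edgeTriple_tau {a : ℂ} (ha : a ≠ 0) (b l₀ : ℂ) (N : ℕ) :
    EdgeTriple a b (fun n m => tau (ser a b l₀ n m) N) (fun n m => tau (ser a b l₀ n m) (N + 1))
      fun n m => tau (ser a b l₀ n m) (N + 2) where
  left n m := by
    simpa using tau_bilinear_of_shift (k := 1) (l := 0)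
      (fun n m => by rw [add_zero, ser_succ_left]) (exists_tau_ne_zero ha b l₀ N).1
      (exists_tau_ne_zero ha b l₀ N).2 n m
  right n m := by
    simpa using tau_bilinear_of_shift (k := 0) (l := 1)
      (fun n m => by rw [add_zero, ser_succ_right]) (exists_tau_ne_zero ha b l₀ N).1
      (exists_tau_ne_zero ha b l₀ N).2 n m

theorem squarePair_tau {a b : ℂ} (ha : a ≠ 0) (hab : a ≠ b) (l₀ : ℂ) (N : ℕ) :
    SquarePair a b (fun n m => tau (ser a b l₀ n m) N)
      fun n m => tau (ser a b l₀ n m) (N + 1) := by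
  induction N with
  | zero =>
    constructor <;> intro n m <;>
      simp only [tau_zero, tau_one_succ_left, tau_one_succ_right, zero_add] <;> ring
  | succ N ih =>
    have hp := isPoly_tau a b l₀
    have hR := edgeTriple_tau ha b l₀ N
    have h0 := (exists_tau_ne_zero ha b l₀ N).1
    exact ih.succ hR (ih.squareTriple hab hR (hp N) (hp (N + 1)) (hp (N + 2)) h0)
      (hp N) (hp (N + 1)) (hp (N + 2)) h0

theorem squareTriple_tau {a b : ℂ} (ha : a ≠ 0) (hab : a ≠ b) (l₀ : ℂ) (N : ℕ) :
    SquareTriple a b (fun n m => tau (ser a b l₀ n m) N)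
      (fun n m => tau (ser a b l₀ n m) (N + 1)) fun n m => tau (ser a b l₀ n m) (N + 2) :=
  have hp := isPoly_tau a b l₀
  (squarePair_tau ha hab l₀ N).squareTriple hab (edgeTriple_tau ha b l₀ N) (hp N) (hp (N + 1))
    (hp (N + 2)) (exists_tau_ne_zero ha b l₀ N).1

/-! ### Extension of the bilinear relations to all integer orders. -/

theorem f_natCast (a b l₀ : ℂ) (N : ℕ) (n m : ℤ) :
    f a b l₀ (N : ℤ) n m = tau (ser a b l₀ n m) N :=
  casoratian_eq_tau a b l₀ N n m

theorem f_negSucc (a b l₀ : ℂ) (N : ℕ) (n m : ℤ) :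
    f a b l₀ (Int.negSucc N) n m = (-1) ^ ((N + 1) / 2) * f a b l₀ (N : ℤ) n m := rfl

theorem neg_one_pow_mul_self (k : ℕ) : (-1 : ℂ) ^ k * (-1) ^ k = 1 := by
  rw [← mul_pow]
  simp

theorem f_zero (a b l₀ : ℂ) : f a b l₀ 0 = fun _ _ => 1 := by
  funext n m
  simpa [tau_zero] using f_natCast a b l₀ 0 n m

theorem f_neg_one (a b l₀ : ℂ) : f a b l₀ (-1) = fun _ _ => 1 := by
  funext n m
  simpa [f_zero] using f_negSucc a b l₀ 0 n m

/-- The tau functions around order `-(k + 1)` are up to signs those around order `k`, reversed. -/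
theorem exists_f_negSucc (a b l₀ : ℂ) (k : ℕ) : ∃ ε ε' : ℂ, ε * ε = 1 ∧ ε' * ε' = 1 ∧
    f a b l₀ (Int.negSucc k - 1) = (fun n m => -ε * f a b l₀ (k + 1) n m) ∧
    f a b l₀ (Int.negSucc k) = (fun n m => ε' * f a b l₀ k n m) ∧
    f a b l₀ (Int.negSucc k + 1) = fun n m => ε * f a b l₀ (k - 1) n m := by
  -- The sign (-1)^⌊K/2⌋ flips when K grows by 2, which gives the outer functions the opposite signs
  -- that reversal requires.
  refine ⟨(-1) ^ (k / 2), (-1) ^ ((k + 1) / 2), neg_one_pow_mul_self _, neg_one_pow_mul_self _,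
    ?_, ?_, ?_⟩
  · funext n m
    rw [show Int.negSucc k - 1 = Int.negSucc (k + 1) by omega, f_negSucc,
      show (k + 1 + 1) / 2 = k / 2 + 1 by omega, pow_succ, mul_neg_one]
    simp
  · funext n m
    rw [f_negSucc]
  · funext n m
    rcases k with _ | k
    · simp [f_zero, f_neg_one]
    · rw [show Int.negSucc (k + 1) + 1 = Int.negSucc k by omega, f_negSucc]
      simp

theorem f_natCast_fun (a b l₀ : ℂ) (N : ℕ) :
    f a b l₀ (N : ℤ) = fun n m => tau (ser a b l₀ n m) N := by
  funext n m
  exact f_natCast a b l₀ N n m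

theorem f_succ_fun (a b l₀ : ℂ) (N : ℕ) :
    f a b l₀ ((N : ℤ) + 1) = fun n m => tau (ser a b l₀ n m) (N + 1) := by
  exact_mod_cast f_natCast_fun a b l₀ (N + 1)

theorem edgeTriple_f_natCast {a : ℂ} (ha : a ≠ 0) (b l₀ : ℂ) (k : ℕ) :
    EdgeTriple a b (f a b l₀ ((k : ℤ) - 1)) (f a b l₀ k) (f a b l₀ (k + 1)) := by
  rcases k with _ | k
  · rw [f_succ_fun, Nat.cast_zero, zero_sub, f_zero, f_neg_one]
    constructor <;> intro n m <;> simp [tau_one_succ_left, tau_one_succ_right]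
  · rw [f_succ_fun, f_natCast_fun, Nat.cast_succ, add_sub_cancel_right, f_natCast_fun]
    exact edgeTriple_tau ha b l₀ k

theorem edgeTriple_f {a : ℂ} (ha : a ≠ 0) (b l₀ : ℂ) (N : ℤ) :
    EdgeTriple a b (f a b l₀ (N - 1)) (f a b l₀ N) (f a b l₀ (N + 1)) := by
  rcases N with k | k
  · exact edgeTriple_f_natCast ha b l₀ k
  · obtain ⟨ε, ε', hε, hε', h1, h2, h3⟩ := exists_f_negSucc a b l₀ k
    rw [h1, h2, h3]
    exact (edgeTriple_f_natCast ha b l₀ k).reverse hε hε'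

theorem squareTriple_f_natCast {a b : ℂ} (ha : a ≠ 0) (hab : a ≠ b) (l₀ : ℂ) (k : ℕ) :
    SquareTriple a b (f a b l₀ ((k : ℤ) - 1)) (f a b l₀ k) (f a b l₀ (k + 1)) := by
  rcases k with _ | k
  · rw [f_succ_fun, Nat.cast_zero, zero_sub, f_zero, f_neg_one]
    constructor <;> intro n m <;> simp [tau_one_succ_left, tau_one_succ_right] <;> ring
  · rw [f_succ_fun, f_natCast_fun, Nat.cast_succ, add_sub_cancel_right, f_natCast_fun]
    exact squareTriple_tau ha hab l₀ k

theorem squareTriple_f {a b : ℂ} (ha : a ≠ 0) (hab : a ≠ b) (l₀ : ℂ) (N : ℤ) :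
    SquareTriple a b (f a b l₀ (N - 1)) (f a b l₀ N) (f a b l₀ (N + 1)) := by
  rcases N with k | k
  · exact squareTriple_f_natCast ha hab l₀ k
  · obtain ⟨ε, ε', hε, hε', h1, h2, h3⟩ := exists_f_negSucc a b l₀ k
    rw [h1, h2, h3]
    exact (squareTriple_f_natCast ha hab l₀ k).reverse hε hε'

theorem squarePair_f {a b : ℂ} (ha : a ≠ 0) (hab : a ≠ b) (l₀ : ℂ) (N : ℤ) :
    SquarePair a b (f a b l₀ N) (f a b l₀ (N + 1)) := by
  -- Starting from the pair of orders -1 and 0 lets the reversal also reach that pair and all below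
  -- it.
  have hk : ∀ k : ℕ, SquarePair a b (f a b l₀ ((k : ℤ) - 1)) (f a b l₀ k) := fun k => by
    rcases k with _ | k
    · rw [Nat.cast_zero, zero_sub, f_zero, f_neg_one]
      constructor <;> simp
    · rw [f_natCast_fun, Nat.cast_succ, add_sub_cancel_right, f_natCast_fun]
      exact squarePair_tau ha hab l₀ k
  rcases N with k | k
  · simpa using hk (k + 1)
  · obtain ⟨ε, ε', -, -, -, h2, h3⟩ := exists_f_negSucc a b l₀ k
    rw [h2, h3]
    exact (hk k).reverse ε' ε

theorem isPoly_f (a b l₀ : ℂ) (N : ℤ) : IsPoly (f a b l₀ N) := by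
  have hk : ∀ k : ℕ, IsPoly (f a b l₀ (k : ℤ)) := fun k => by
    rw [f_natCast_fun]
    exact isPoly_tau a b l₀ k
  rcases N with k | k
  · exact hk k
  · exact (IsPoly.const _).mul (hk k)

theorem exists_f_ne_zero {a : ℂ} (ha : a ≠ 0) (b l₀ : ℂ) (N : ℤ) : ∃ n m, f a b l₀ N n m ≠ 0 := by
  have hk : ∀ k : ℕ, ∃ n m, f a b l₀ (k : ℤ) n m ≠ 0 := fun k => by
    rw [f_natCast_fun]
    exact (exists_tau_ne_zero ha b l₀ k).1
  rcases N with k | k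
  · exact hk k
  · obtain ⟨n, m, h⟩ := hk k
    exact ⟨n, m, by rw [f_negSucc]; exact mul_ne_zero (pow_ne_zero _ (by simp)) h⟩

theorem f_left_eq_right (a l₀ : ℂ) (N : ℤ) (n m : ℤ) :
    f a a l₀ N (n + 1) m = f a a l₀ N n (m + 1) := by
  have hk : ∀ k : ℕ, f a a l₀ (k : ℤ) (n + 1) m = f a a l₀ (k : ℤ) n (m + 1) := fun k => by
    rw [f_natCast, f_natCast, ser_succ_left, ser_succ_right]
  rcases N with k | k
  · exact hk k
  · rw [f_negSucc, f_negSucc, hk]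

/-! ### Rationality, the Bäcklund transformation, Q1 and H3*. -/

theorem isRationalFunctionOn_div {F G H : ℤ → ℤ → ℂ} (hF : IsPoly F) (hG : IsPoly G)
    (h0 : ∃ n m, H n m ≠ 0) (hGH : ∀ n m, H n m ≠ 0 ↔ G n m ≠ 0) :
    IsRationalFunctionOn (fun n m => H n m ≠ 0) fun n m => F n m / G n m := by
  obtain ⟨P, hP⟩ := hF
  obtain ⟨Q, hQ⟩ := hG
  refine ⟨P, Q, ?_, fun n m => ⟨by rw [← hQ]; exact hGH n m, fun _ => by simp only [hP, hQ]⟩⟩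
  rintro rfl
  obtain ⟨n, m, h⟩ := h0
  rw [hGH, hQ] at h
  simp at h

/-- The edge relations centred at N+1 and N-1 eliminate the orders N±2. -/
theorem uSol_left_sub {a : ℂ} (ha : a ≠ 0) (b δ l₀ : ℂ) {N n m : ℤ} (h0 : f a b l₀ N n m ≠ 0)
    (h1 : f a b l₀ N (n + 1) m ≠ 0) :
    uSol a b δ l₀ N (n + 1) m - uSol a b δ l₀ N n m =
      a * (f a b l₀ (N + 1) n m * f a b l₀ (N + 1) (n + 1) m
        - δ ^ 2 * (f a b l₀ (N - 1) n m * f a b l₀ (N - 1) (n + 1) m)) /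
        (f a b l₀ N n m * f a b l₀ N (n + 1) m) := by
  have e1 := (edgeTriple_f ha b l₀ (N + 1)).left n m
  have e2 := (edgeTriple_f ha b l₀ (N - 1)).left n m
  rw [add_sub_cancel_right, show N + 1 + 1 = N + 2 by ring] at e1
  rw [sub_add_cancel, show N - 1 - 1 = N - 2 by ring] at e2
  rw [uSol, uSol, div_sub_div _ _ h1 h0, div_eq_div_iff (mul_ne_zero h1 h0) (mul_ne_zero h0 h1)]
  linear_combination f a b l₀ N n m * f a b l₀ N (n + 1) m * (e1 - δ ^ 2 * e2)

theorem uSol_right_sub {a : ℂ} (ha : a ≠ 0) (b δ l₀ : ℂ) {N n m : ℤ} (h0 : f a b l₀ N n m ≠ 0)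
    (h1 : f a b l₀ N n (m + 1) ≠ 0) :
    uSol a b δ l₀ N n (m + 1) - uSol a b δ l₀ N n m =
      b * (f a b l₀ (N + 1) n m * f a b l₀ (N + 1) n (m + 1)
        - δ ^ 2 * (f a b l₀ (N - 1) n m * f a b l₀ (N - 1) n (m + 1))) /
        (f a b l₀ N n m * f a b l₀ N n (m + 1)) := by
  have e1 := (edgeTriple_f ha b l₀ (N + 1)).right n m
  have e2 := (edgeTriple_f ha b l₀ (N - 1)).right n m
  rw [add_sub_cancel_right, show N + 1 + 1 = N + 2 by ring] at e1
  rw [sub_add_cancel, show N - 1 - 1 = N - 2 by ring] at e2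
  rw [uSol, uSol, div_sub_div _ _ h1 h0, div_eq_div_iff (mul_ne_zero h1 h0) (mul_ne_zero h0 h1)]
  linear_combination f a b l₀ N n m * f a b l₀ N n (m + 1) * (e1 - δ ^ 2 * e2)

/-- Brahmagupta's identity: (x₀x₁ - δ²y₀y₁)² - (x₀² - δ²y₀²)(x₁² - δ²y₁²) = δ²(x₁y₀ - x₀y₁)². -/
theorem backlund_identity {a δ x₀ x₁ y₀ y₁ f₀ f₁ : ℂ} (h0 : f₀ ≠ 0) (h1 : f₁ ≠ 0)
    (h : x₁ * y₀ - x₀ * y₁ = a * f₀ * f₁) :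
    (a * (x₀ * x₁ - δ ^ 2 * (y₀ * y₁)) / (f₀ * f₁)) ^ 2 - δ ^ 2 * (a ^ 2) ^ 2 =
      a ^ 2 * ((x₀ ^ 2 - δ ^ 2 * y₀ ^ 2) / f₀ ^ 2) * ((x₁ ^ 2 - δ ^ 2 * y₁ ^ 2) / f₁ ^ 2) := by
  field_simp
  linear_combination a ^ 2 * δ ^ 2 * (x₁ * y₀ - x₀ * y₁ + a * f₀ * f₁) * h

theorem btHorizontalAt {a : ℂ} (ha : a ≠ 0) (b δ l₀ : ℂ) {N n m : ℤ} (h0 : f a b l₀ N n m ≠ 0)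
    (h1 : f a b l₀ N (n + 1) m ≠ 0) :
    BTHorizontalAt δ (a ^ 2) (uSol a b δ l₀ N) (USol a b δ l₀ N) n m := by
  rw [BTHorizontalAt, uSol_left_sub ha b δ l₀ h0 h1]
  exact backlund_identity h0 h1 ((edgeTriple_f ha b l₀ N).left n m)

theorem btVerticalAt {a : ℂ} (ha : a ≠ 0) (b δ l₀ : ℂ) {N n m : ℤ} (h0 : f a b l₀ N n m ≠ 0)
    (h1 : f a b l₀ N n (m + 1) ≠ 0) :
    BTVerticalAt δ (b ^ 2) (uSol a b δ l₀ N) (USol a b δ l₀ N) n m := by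
  rw [BTVerticalAt, uSol_right_sub ha b δ l₀ h0 h1]
  exact backlund_identity h0 h1 ((edgeTriple_f ha b l₀ N).right n m)

/-- The difference of the two products of numerators factors as -a²b²δ²(x₁y₂ - x₂y₁)(x₃y₀ - x₀y₃),
and the two diagonal relations evaluate the factors. -/
theorem q1_identity {a b δ x₀ x₁ x₂ x₃ y₀ y₁ y₂ y₃ f₀ f₁ f₂ f₃ : ℂ} (h0 : f₀ ≠ 0) (h1 : f₁ ≠ 0)
    (h2 : f₂ ≠ 0) (h3 : f₃ ≠ 0) (anti : x₁ * y₂ - x₂ * y₁ = (a - b) * f₀ * f₃)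
    (diag : x₃ * y₀ - x₀ * y₃ = (a + b) * f₁ * f₂) :
    a ^ 2 * (b * (x₀ * x₂ - δ ^ 2 * (y₀ * y₂)) / (f₀ * f₂))
        * (b * (x₁ * x₃ - δ ^ 2 * (y₁ * y₃)) / (f₁ * f₃))
      - b ^ 2 * (a * (x₀ * x₁ - δ ^ 2 * (y₀ * y₁)) / (f₀ * f₁))
        * (a * (x₂ * x₃ - δ ^ 2 * (y₂ * y₃)) / (f₂ * f₃))
      + δ ^ 2 * a ^ 2 * b ^ 2 * (a ^ 2 - b ^ 2) = 0 := by
  field_simp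
  linear_combination -a ^ 2 * b ^ 2 * δ ^ 2 * ((x₃ * y₀ - x₀ * y₃) * anti
    + (a - b) * f₀ * f₃ * diag)

theorem q1At {a : ℂ} (ha : a ≠ 0) (b δ l₀ : ℂ) {N n m : ℤ} (h0 : f a b l₀ N n m ≠ 0)
    (h1 : f a b l₀ N (n + 1) m ≠ 0) (h2 : f a b l₀ N n (m + 1) ≠ 0)
    (h3 : f a b l₀ N (n + 1) (m + 1) ≠ 0) :
    Q1At δ (a ^ 2) (b ^ 2) (uSol a b δ l₀ N) n m := by
  rw [Q1At]
  rcases eq_or_ne a b with rfl | hab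
  · have h : uSol a a δ l₀ N (n + 1) m = uSol a a δ l₀ N n (m + 1) := by
      simp only [uSol, f_left_eq_right]
    rw [h]
    ring
  · have hS := squareTriple_f ha hab l₀ N
    have d1 := uSol_left_sub ha b δ l₀ h0 h1
    have d2 := uSol_right_sub ha b δ l₀ h0 h2
    have d3 := uSol_left_sub ha b δ l₀ h2 h3
    have d4 := uSol_right_sub ha b δ l₀ h1 h3
    have key := q1_identity (δ := δ) h0 h1 h2 h3 (hS.anti n m) (hS.diag n m)
    rw [← d1, ← d2, ← d3, ← d4] at key
    linear_combination key

/-- The same h scales the linear relations and is the 2×2 determinant of the values at vertices 1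
and 2. Eliminating vertices 0 and 3, and then h, leaves a polynomial identity in a, b, δ, x₁, x₂,
y₁, y₂. -/
theorem h3Star_identity {a b δ h x₀ x₁ x₂ x₃ y₀ y₁ y₂ y₃ : ℂ} (hh : h ≠ 0)
    (hx0 : h * x₀ = a * x₂ - b * x₁) (hx3 : h * x₃ = a * x₁ - b * x₂)
    (hy0 : h * y₀ = a * y₂ - b * y₁) (hy3 : h * y₃ = a * y₁ - b * y₂)
    (hxy : x₁ * y₂ - x₂ * y₁ = h) :
    (a ^ 2 * ((x₀ ^ 2 - δ ^ 2 * y₀ ^ 2) * (x₁ ^ 2 - δ ^ 2 * y₁ ^ 2)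
          - (x₂ ^ 2 - δ ^ 2 * y₂ ^ 2) * (x₃ ^ 2 - δ ^ 2 * y₃ ^ 2))
        - b ^ 2 * ((x₀ ^ 2 - δ ^ 2 * y₀ ^ 2) * (x₂ ^ 2 - δ ^ 2 * y₂ ^ 2)
          - (x₁ ^ 2 - δ ^ 2 * y₁ ^ 2) * (x₃ ^ 2 - δ ^ 2 * y₃ ^ 2))) ^ 2
      + 4 * a ^ 2 * b ^ 2 * ((x₁ ^ 2 - δ ^ 2 * y₁ ^ 2) - (x₂ ^ 2 - δ ^ 2 * y₂ ^ 2))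
        * (δ ^ 2 * (a ^ 2 - b ^ 2) * ((x₀ ^ 2 - δ ^ 2 * y₀ ^ 2) - (x₃ ^ 2 - δ ^ 2 * y₃ ^ 2))
          - (x₀ ^ 2 - δ ^ 2 * y₀ ^ 2) * (x₃ ^ 2 - δ ^ 2 * y₃ ^ 2)
            * ((x₁ ^ 2 - δ ^ 2 * y₁ ^ 2) - (x₂ ^ 2 - δ ^ 2 * y₂ ^ 2))) = 0 := by
  obtain rfl : x₀ = (a * x₂ - b * x₁) / h := by rw [eq_div_iff hh, mul_comm, hx0]
  obtain rfl : x₃ = (a * x₁ - b * x₂) / h := by rw [eq_div_iff hh, mul_comm, hx3]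
  obtain rfl : y₀ = (a * y₂ - b * y₁) / h := by rw [eq_div_iff hh, mul_comm, hy0]
  obtain rfl : y₃ = (a * y₁ - b * y₂) / h := by rw [eq_div_iff hh, mul_comm, hy3]
  field_simp
  subst hxy
  ring

theorem h3StarFormAt {a : ℂ} (ha : a ≠ 0) (b δ l₀ : ℂ) {N n m : ℤ} (h0 : f a b l₀ N n m ≠ 0)
    (h1 : f a b l₀ N (n + 1) m ≠ 0) (h2 : f a b l₀ N n (m + 1) ≠ 0)
    (h3 : f a b l₀ N (n + 1) (m + 1) ≠ 0) :
    H3StarFormAt δ (a ^ 2) (b ^ 2) (USol a b δ l₀ N) n m := by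
  rw [H3StarFormAt]
  rcases eq_or_ne a b with rfl | hab
  · have h : USol a a δ l₀ N (n + 1) m = USol a a δ l₀ N n (m + 1) := by
      simp only [USol, f_left_eq_right]
    rw [h]
    ring
  · have hS := (squareTriple_f ha hab l₀ N).anti n m
    have hU := squarePair_f ha hab l₀ N
    have hL := squarePair_f ha hab l₀ (N - 1)
    rw [sub_add_cancel] at hL
    have u1 := hU.upper n m
    have u2 := hU.lower n m
    have v1 := hL.upper n m
    have v2 := hL.lower n m
    have hUS : ∀ i j, USol a b δ l₀ N i j = (f a b l₀ (N + 1) i j / f a b l₀ N i j) ^ 2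
        - δ ^ 2 * (f a b l₀ (N - 1) i j / f a b l₀ N i j) ^ 2 := fun i j => by
      rw [USol]
      ring
    simp only [hUS]
    -- Here x and y are f_{N+1}/f_N and f_{N-1}/f_N; h is the value that the antidiagonal relation
    -- gives to x₁y₂ - x₂y₁.
    refine h3Star_identity (h := (a - b) * (f a b l₀ N n m * f a b l₀ N (n + 1) (m + 1)) /
      (f a b l₀ N (n + 1) m * f a b l₀ N n (m + 1))) ?_ ?_ ?_ ?_ ?_ ?_
    · have := sub_ne_zero.2 hab
      positivity
    · field_simp
      linear_combination -u2
    · field_simp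
      linear_combination -u1
    · field_simp
      linear_combination -v1
    · field_simp
      linear_combination -v2
    · field_simp
      linear_combination hS

/-- Multiplied by p²q², the standard form becomes the other one. With A = U Û - Ũ Û̃ and B = U Ũ - Û
Û̃ this rests on (A - B)² = (Ũ - Û)²((U - Û̃)² + 4U Û̃). -/
theorem h3StarAt_of_form {δ p q : ℂ} (hp : p ≠ 0) (hq : q ≠ 0) {U : ℤ → ℤ → ℂ} {n m : ℤ}
    (h : H3StarFormAt δ p q U n m) : H3StarAt δ (1 / p) (1 / q) U n m := by
  rw [H3StarFormAt] at h
  rw [H3StarAt]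
  field_simp
  linear_combination h

end LatticeH3

end

theorem mainTheorem5 (a b δ l₀ : ℂ) (ha : a ≠ 0) (hb : b ≠ 0) (N : ℤ) :
    -- both functions are rational in `(n, m)`, defined wherever `f_N` does not vanish
    LatticeH3.IsRationalFunctionOn (fun n m => LatticeH3.f a b l₀ N n m ≠ 0)
      (LatticeH3.USol a b δ l₀ N) ∧
    LatticeH3.IsRationalFunctionOn (fun n m => LatticeH3.f a b l₀ N n m ≠ 0)
      (LatticeH3.uSol a b δ l₀ N) ∧
    -- `U_{N+2}` solves H3*(δ), with `p = a²`, `q = b²`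
    (∀ n m : ℤ, LatticeH3.f a b l₀ N n m ≠ 0 → LatticeH3.f a b l₀ N (n + 1) m ≠ 0 →
      LatticeH3.f a b l₀ N n (m + 1) ≠ 0 → LatticeH3.f a b l₀ N (n + 1) (m + 1) ≠ 0 →
        LatticeH3.H3StarFormAt δ (a ^ 2) (b ^ 2) (LatticeH3.USol a b δ l₀ N) n m ∧
        LatticeH3.H3StarAt δ (1 / a ^ 2) (1 / b ^ 2) (LatticeH3.USol a b δ l₀ N) n m) ∧
    -- `u_{N+2}` solves Q1(δ)
    (∀ n m : ℤ, LatticeH3.f a b l₀ N n m ≠ 0 → LatticeH3.f a b l₀ N (n + 1) m ≠ 0 →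
      LatticeH3.f a b l₀ N n (m + 1) ≠ 0 → LatticeH3.f a b l₀ N (n + 1) (m + 1) ≠ 0 →
        LatticeH3.Q1At δ (a ^ 2) (b ^ 2) (LatticeH3.uSol a b δ l₀ N) n m) ∧
    -- the two are related by the Bäcklund transformation
    (∀ n m : ℤ, LatticeH3.f a b l₀ N n m ≠ 0 → LatticeH3.f a b l₀ N (n + 1) m ≠ 0 →
      LatticeH3.BTHorizontalAt δ (a ^ 2) (LatticeH3.uSol a b δ l₀ N)
        (LatticeH3.USol a b δ l₀ N) n m) ∧
    (∀ n m : ℤ, LatticeH3.f a b l₀ N n m ≠ 0 → LatticeH3.f a b l₀ N n (m + 1) ≠ 0 →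
      LatticeH3.BTVerticalAt δ (b ^ 2) (LatticeH3.uSol a b δ l₀ N)
        (LatticeH3.USol a b δ l₀ N) n m) := by
  have hp := LatticeH3.isPoly_f a b l₀
  have h0 := LatticeH3.exists_f_ne_zero ha b l₀ N
  have hsq : ∀ {F : ℤ → ℤ → ℂ}, LatticeH3.IsPoly F → LatticeH3.IsPoly fun n m => F n m ^ 2 :=
    fun hF => by simpa only [pow_two] using hF.mul hF
  refine ⟨?_, ?_, fun n m h0 h1 h2 h3 => ?_, fun n m => LatticeH3.q1At ha b δ l₀,
    fun n m => LatticeH3.btHorizontalAt ha b δ l₀, fun n m => LatticeH3.btVerticalAt ha b δ l₀⟩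
  · exact LatticeH3.isRationalFunctionOn_div
      ((hsq (hp (N + 1))).sub ((LatticeH3.IsPoly.const _).mul (hsq (hp (N - 1)))))
      (hsq (hp N)) h0 fun n m => (pow_ne_zero_iff two_ne_zero).symm
  · exact LatticeH3.isRationalFunctionOn_div
      ((hp (N + 2)).add ((LatticeH3.IsPoly.const _).mul (hp (N - 2)))) (hp N) h0
      fun n m => Iff.rfl
  · have h := LatticeH3.h3StarFormAt ha b δ l₀ h0 h1 h2 h3
    exact ⟨h, LatticeH3.h3StarAt_of_form (pow_ne_zero 2 ha) (pow_ne_zero 2 hb) h⟩
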